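/- Consider $n$ items with independent outcomes $X_1,\dots,X_n\in\{0,1\}$, $\Pr[X_i=1]=p_i$, testing costs $c_i\ge 0$ and a setup cost $\rho\ge 0$. Testing a set $S$ of items simultaneously (a batch) reveals $X_i$ for all $i\in S$ and costs $\rho+\sum_{i\in S}c_i$. An adaptive batched policy selects a sequence of batches, where each batch may depend on the outcomes observed so far; a non-adaptive batched policy is a fixed sequence of pairwise disjoint batches, which are tested in this order until the task below is completed (no batch is tested if the task needs no outcome at all). A policy is feasible for a task if, for every outcome vector, the task is completed when the policy stops. Two tasks are considered. (1) Stochastic score classification: given integer weights $w_1,\dots,w_n$ (of any sign) and integer thresholds $\alpha_1<\alpha_2<\dots<\alpha_{B+1}$ such that $\alpha_1\le\sum_{i=1}^n w_ix_i<\alpha_{B+1}$ for all $x\in\{0,1\}^n$, let $f(X)$ be the $j\in\{1,\dots,B\}$ with $\alpha_j\le\sum_i w_iX_i<\alpha_{j+1}$. The task is completed when the outcomes of the tested items determine $f(X)$, whatever the outcomes of the untested items are. (2) Explainable stochastic $d$-halfspace evaluation: given $d$ halfspaces $h_k(X)=\mathbf 1\big[\sum_{i=1}^n w_{ki}X_i\ge\alpha_k\big]$,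 $k=1,\dots,d$, with integer $w_{ki}$ (of any sign) and $\alpha_k$, and a function $f:\{0,1\}^d\to\{0,1\}$, the value $f(h_1(X),\dots,h_d(X))$ is to be found together with a witness. The task is completed when there is a set $T\subseteq\{1,\dots,d\}$ such that the outcomes of the tested items determine $h_k(X)$ for every $k\in T$, and $f(y)$ has the same value for all $y\in\{0,1\}^d$ with $y_k=h_k(X)$ for all $k\in T$. Theorem. There is an absolute constant $C$ such that every instance of (1) has a feasible non-adaptive batched policy whose expected cost is at most $C$ times the expected cost of every feasible adaptive batched policy (in particular, of an optimal one). There is an absolute constant $C$ such that, for every $d$, every instance of (2) has a feasible non-adaptive batched policy whose expected cost is at most $C\,d^2\log(d+1)$ times the expected cost of every feasible adaptive batched policy; that is, the approximation ratio is $O(d^2\log d)$ for $d\ge2$ and $O(1)$ for $d=1$. -/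

import Mathlib

namespace SeqTesting

/-! Sequential testing of `n` independent Bernoulli items under batch costs.
An outcome vector in `{0,1}^n` is a function `Fin n → Bool`. -/

/-- `n` items: item `i` works with probability `p i` independently of the others, and
testing a set `S` of items in one batch costs `ρ + ∑ i ∈ S, c i`. -/
structure Items (n : ℕ) where
  p : Fin n → ℝ
  c : Fin n → ℝ
  ρ : ℝ
  p_nonneg : ∀ i, 0 ≤ p i
  p_le_one : ∀ i, p i ≤ 1
  c_nonneg : ∀ i, 0 ≤ c i
  ρ_nonneg : 0 ≤ ρ

namespace Items

variable {n : ℕ} (P : Items n)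

/-- Probability of the outcome vector `x`. -/
noncomputable def prob (x : Fin n → Bool) : ℝ :=
  ∏ i, if x i then P.p i else 1 - P.p i

/-- Expectation of a function of the random outcome vector. -/
noncomputable def expect (F : (Fin n → Bool) → ℝ) : ℝ :=
  ∑ x, P.prob x * F x

/-- Cost of testing the items of `S` simultaneously. -/
noncomputable def batchCost (S : Finset (Fin n)) : ℝ :=
  P.ρ + ∑ i ∈ S, P.c i

end Items

/-- `x` and `y` agree on the tested items `S`. -/
def AgreeOn {n : ℕ} (S : Finset (Fin n)) (x y : Fin n → Bool) : Prop :=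
  ∀ i ∈ S, y i = x i

/-! ### Policies

A testing task is given by a predicate `Done S x`: the outcomes under `x` of the items in `S`
suffice to complete the task. -/

/-- A (deterministic) adaptive batched policy: either halt, or test a batch `S` and continue in
a way that depends on the outcomes of the items in `S` (and, through the position in the tree, on
all earlier outcomes).  Testing an item again is not forbidden, but is paid for again. -/
inductive AdaptivePolicy (n : ℕ) : Type where
  | halt : AdaptivePolicy n
  | test (S : Finset (Fin n)) (next : (S → Bool) → AdaptivePolicy n) : AdaptivePolicy n

namespace AdaptivePolicy

variable {n : ℕ}

/-- The set of items tested under the outcome vector `x`. -/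
def tested : AdaptivePolicy n → (Fin n → Bool) → Finset (Fin n)
  | halt, _ => ∅
  | test S next, x => S ∪ (next fun i => x i).tested x

/-- Total cost under the outcome vector `x`. -/
noncomputable def cost (P : Items n) : AdaptivePolicy n → (Fin n → Bool) → ℝ
  | halt, _ => 0
  | test S next, x => P.batchCost S + (next fun i => x i).cost P x

/-- The policy is feasible: it never halts before the task is completed. -/
def Feasible (Done : Finset (Fin n) → (Fin n → Bool) → Prop) (A : AdaptivePolicy n) : Prop :=
  ∀ x, Done (A.tested x) x

/-- Expected cost. -/
noncomputable def expectedCost (P : Items n) (A : AdaptivePolicy n) : ℝ :=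
  P.expect fun x => A.cost P x

end AdaptivePolicy

/-- A non-adaptive batched policy: a fixed sequence of pairwise disjoint batches. -/
structure NonAdaptivePolicy (n : ℕ) where
  batches : List (Finset (Fin n))
  disjoint : batches.Pairwise Disjoint

open Classical in
/-- Cost, under the outcome vector `x`, of testing the listed batches in order until the task is
completed, when the items in `U` have been tested already. -/
noncomputable def runCost {n : ℕ} (P : Items n)
    (Done : Finset (Fin n) → (Fin n → Bool) → Prop) (x : Fin n → Bool) :
    Finset (Fin n) → List (Finset (Fin n)) → ℝ
  | _, [] => 0
  | U, S :: L => if Done U x then 0 else P.batchCost S + runCost P Done x (U ∪ S) L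

namespace NonAdaptivePolicy

variable {n : ℕ}

/-- The policy is feasible: for every outcome vector, the task is completed after some of the
batches (possibly none of them) have been tested. -/
def Feasible (Done : Finset (Fin n) → (Fin n → Bool) → Prop) (N : NonAdaptivePolicy n) : Prop :=
  ∀ x, ∃ t, Done ((N.batches.take t).foldr (· ∪ ·) ∅) x

/-- Expected cost. -/
noncomputable def expectedCost (P : Items n) (Done : Finset (Fin n) → (Fin n → Bool) → Prop)
    (N : NonAdaptivePolicy n) : ℝ :=
  P.expect fun x => runCost P Done x ∅ N.batches

end NonAdaptivePolicy

/-! ### Stochastic score classification -/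

/-- A score classification function on `n` items with `B` classes: integer weights and integer
thresholds `α 0 < α 1 < ⋯ < α B` such that every possible total weight lies in `[α 0, α B)`. -/
structure ScoreClass (n B : ℕ) where
  w : Fin n → ℤ
  α : Fin (B + 1) → ℤ
  α_strictMono : StrictMono α
  α_first : ∀ x : Fin n → Bool, α 0 ≤ ∑ i, if x i then w i else 0
  α_last : ∀ x : Fin n → Bool, (∑ i, if x i then w i else 0) < α (Fin.last B)

namespace ScoreClass

variable {n B : ℕ} (I : ScoreClass n B)

/-- Total weight of the working items. -/
def weight (x : Fin n → Bool) : ℤ := ∑ i, if x i then I.w i else 0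

/-- The weight of `x` lies in class `j`, the integer interval `[α j, α (j + 1))`. -/
def InClass (x : Fin n → Bool) (j : Fin B) : Prop :=
  I.α j.castSucc ≤ I.weight x ∧ I.weight x < I.α j.succ

theorem existsUnique_inClass (x : Fin n → Bool) : ∃! j, I.InClass x j := by
  have hex : ∃ j, I.InClass x j := by
    by_contra hcon
    have key : ∀ k : Fin (B + 1), I.α k ≤ I.weight x := by
      intro k
      induction k using Fin.induction with
      | zero => exact I.α_first x
      | succ j ih =>
        by_contra hj
        exact hcon ⟨j, ih, not_le.mp hj⟩
    exact absurd (I.α_last x) (not_lt.mpr (key (Fin.last B)))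
  obtain ⟨j, hj⟩ := hex
  refine ⟨j, hj, fun k hk => ?_⟩
  have h1 : k.castSucc < j.succ := I.α_strictMono.lt_iff_lt.mp (lt_of_le_of_lt hk.1 hj.2)
  have h2 : j.castSucc < k.succ := I.α_strictMono.lt_iff_lt.mp (lt_of_le_of_lt hj.1 hk.2)
  simp only [Fin.lt_def, Fin.val_castSucc, Fin.val_succ] at h1 h2
  exact Fin.ext (by omega)

/-- The score classification function: the class that contains the total weight. -/
noncomputable def f (x : Fin n → Bool) : Fin B := (I.existsUnique_inClass x).choose

/-- The outcomes under `x` of the items in `S` determine the value of `f`. -/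
def Determined (S : Finset (Fin n)) (x : Fin n → Bool) : Prop :=
  ∀ y, AgreeOn S x y → I.f y = I.f x

end ScoreClass

/-! ### Explainable stochastic `d`-halfspace evaluation -/

/-- `d` halfspaces `∑ i, w k i * X i ≥ α k` and an aggregation function. -/
structure Halfspaces (n d : ℕ) where
  w : Fin d → Fin n → ℤ
  α : Fin d → ℤ
  f : (Fin d → Bool) → Bool

namespace Halfspaces

variable {n d : ℕ} (I : Halfspaces n d)

/-- The vector of truth values of the halfspaces. -/
def h (x : Fin n → Bool) : Fin d → Bool :=
  fun k => decide (I.α k ≤ ∑ i, if x i then I.w k i else 0)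

/-- The tested items `S`, their outcomes under `x` and the set `T` of halfspaces form a witness
for `f ∘ h`: the outcomes determine every halfspace in `T`, and the values of the halfspaces in
`T` determine the value of `f`. -/
def IsWitness (S : Finset (Fin n)) (x : Fin n → Bool) (T : Finset (Fin d)) : Prop :=
  (∀ k ∈ T, ∀ y, AgreeOn S x y → I.h y k = I.h x k) ∧
    ∀ z : Fin d → Bool, (∀ k ∈ T, z k = I.h x k) → I.f z = I.f (I.h x)

/-- The outcomes under `x` of the items in `S` yield the value of `f ∘ h` with a witness. -/
def Witnessed (S : Finset (Fin n)) (x : Fin n → Bool) : Prop :=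
  ∃ T, I.IsWitness S x T

end Halfspaces

end SeqTesting

/-! Both tasks ask for bounds on linear scores. The best lower bound on a score that the outcomes on
`T` certify is a constant plus a `reward` of `T`; upper bounds are lower bounds for the negated
weights. So completion is monotone in `m` rewards (`IsRewardTask`), with `m = 2` for a score,
whatever the number of classes, and `m = 2 * d` for `d` halfspaces. It suffices to collect as much
of each reward as an adaptive policy does.

`exists_dominating_batch` achieves this for one reward and one budget `L`. It buys items greedily by
expected reward per cost, and the first item left out sets a scale `τ` at which rewards are
truncated. Outside the batch, a policy of cost at most `L` gains less than `τ` except with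
probability `δ / 2` (optional stopping and Markov). The part of the batch that the policy leaves
untested yields at least `τ` except with probability `δ / 2` (Chernoff).

`exists_batch` joins the batches for all `m` rewards with `δ = 1 / (4 * m)`. The probability of
being unfinished then drops to a quarter, up to the probability that the adaptive policy spends more
than `L`. `exists_batches` doubles `L` from phase to phase: budgets grow by 2 while survival shrinks
by 4, so the total is a constant times `phaseFactor m`, of order `m ^ 2 * log m`. -/

namespace SeqTesting

/-- `F` does not depend on the coordinate `i`. -/
def IgnoresCoord {n : ℕ} {β : Type*} (F : (Fin n → Bool) → β) (i : Fin n) : Prop :=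
  ∀ x b, F (Function.update x i b) = F x

/-! ### Expectations and independence under the product measure -/

namespace Items

variable {n : ℕ} (P : Items n)

/-- Probability that item `i` has outcome `b`. -/
noncomputable def outcomeProb (i : Fin n) (b : Bool) : ℝ := if b then P.p i else 1 - P.p i

theorem outcomeProb_nonneg (i : Fin n) (b : Bool) : 0 ≤ P.outcomeProb i b := by
  have h0 := P.p_nonneg i
  have h1 := P.p_le_one i
  unfold outcomeProb
  split_ifs <;> linarith

theorem sum_outcomeProb (i : Fin n) : ∑ b, P.outcomeProb i b = 1 := by
  simp [outcomeProb]

theorem prob_nonneg (x : Fin n → Bool) : 0 ≤ P.prob x :=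
  Finset.prod_nonneg fun i _ => P.outcomeProb_nonneg i (x i)

theorem expect_mono {F G : (Fin n → Bool) → ℝ} (h : ∀ x, F x ≤ G x) :
    P.expect F ≤ P.expect G :=
  Finset.sum_le_sum fun x _ => mul_le_mul_of_nonneg_left (h x) (P.prob_nonneg x)

theorem expect_nonneg {F : (Fin n → Bool) → ℝ} (h : ∀ x, 0 ≤ F x) : 0 ≤ P.expect F :=
  Finset.sum_nonneg fun x _ => mul_nonneg (P.prob_nonneg x) (h x)

theorem expect_add (F G : (Fin n → Bool) → ℝ) :
    P.expect (fun x => F x + G x) = P.expect F + P.expect G := by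
  simp [expect, mul_add, Finset.sum_add_distrib]

theorem expect_const_mul (c : ℝ) (F : (Fin n → Bool) → ℝ) :
    P.expect (fun x => c * F x) = c * P.expect F := by
  simp only [expect, Finset.mul_sum]
  exact Finset.sum_congr rfl fun x _ => by ring

theorem expect_mul_const (F : (Fin n → Bool) → ℝ) (c : ℝ) :
    P.expect (fun x => F x * c) = P.expect F * c := by
  simp only [mul_comm _ c, expect_const_mul]

theorem expect_sum {ι : Type*} (s : Finset ι) (F : ι → (Fin n → Bool) → ℝ) :
    P.expect (fun x => ∑ k ∈ s, F k x) = ∑ k ∈ s, P.expect (F k) := by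
  simp only [expect, Finset.mul_sum]
  exact Finset.sum_comm

/-- Fubini in coordinate `i`: `F` is a function of the other coordinates, hence independent of `x
i`. The value `true` in `key` is an arbitrary filler, and `g = 1` identifies the remaining sum as
the expectation of `F`. -/
theorem expect_mul_coord {F : (Fin n → Bool) → ℝ} {i : Fin n} (hF : IgnoresCoord F i)
    (g : Bool → ℝ) :
    P.expect (fun x => F x * g (x i)) = P.expect F * ∑ b, P.outcomeProb i b * g b := by
  have key : ∀ g : Bool → ℝ, P.expect (fun x => F x * g (x i)) =
      (∑ b, P.outcomeProb i b * g b) * ∑ y : ({j // j ≠ i} → Bool),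
        (∏ j : {j // j ≠ i}, P.outcomeProb j (y j)) * F ((Equiv.funSplitAt i Bool).symm (true, y)) := by
    intro g
    unfold expect
    rw [← (Equiv.funSplitAt i Bool).symm.sum_comp, Fintype.sum_prod_type, Finset.sum_mul_sum]
    refine Finset.sum_congr rfl fun b _ => Finset.sum_congr rfl fun y _ => ?_
    have h1 : P.prob ((Equiv.funSplitAt i Bool).symm (b, y)) =
        P.outcomeProb i b * ∏ j : {j // j ≠ i}, P.outcomeProb j (y j) := by
      have : P.prob ((Equiv.funSplitAt i Bool).symm (b, y)) =
        ∏ j, P.outcomeProb j ((Equiv.funSplitAt i Bool).symm (b, y) j) := rfl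
      rw [this, Fintype.prod_eq_mul_prod_subtype_ne _ i]
      congr 1
      · simp
      · refine Finset.prod_congr rfl fun j _ => ?_
        simp [j.2]
    have h2 : F ((Equiv.funSplitAt i Bool).symm (b, y)) =
        F ((Equiv.funSplitAt i Bool).symm (true, y)) := by
      rw [← hF ((Equiv.funSplitAt i Bool).symm (true, y)) b]
      congr 1
      ext j
      by_cases hj : j = i
      · subst hj; simp
      · simp [hj]
    have h3 : (Equiv.funSplitAt i Bool).symm (b, y) i = b := by simp
    rw [h1]
    beta_reduce
    rw [h2, h3]
    ring
  have h1 := key fun _ => 1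
  simp only [mul_one, P.sum_outcomeProb, one_mul] at h1
  rw [key g, ← h1, mul_comm]

theorem expect_mul_prod {F : (Fin n → Bool) → ℝ} {S : Finset (Fin n)}
    (hF : ∀ i ∈ S, IgnoresCoord F i) {Y : Fin n → Bool → ℝ}
    (hY : ∀ i ∈ S, ∑ b, P.outcomeProb i b * Y i b = 1) :
    P.expect (fun x => F x * ∏ i ∈ S, Y i (x i)) = P.expect F := by
  classical
  induction S using Finset.induction_on with
  | empty => simp
  | insert i S hi ih =>
    have h1 : IgnoresCoord (fun x => F x * ∏ j ∈ S, Y j (x j)) i := by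
      intro x b
      simp only [hF i (Finset.mem_insert_self i S) x b]
      congr 1
      refine Finset.prod_congr rfl fun j hj => ?_
      rw [Function.update_of_ne]
      rintro rfl
      exact hi hj
    have h2 := P.expect_mul_coord h1 (Y i)
    rw [hY i (Finset.mem_insert_self i S), mul_one,
      ih (fun j hj => hF j (Finset.mem_insert_of_mem hj))
        (fun j hj => hY j (Finset.mem_insert_of_mem hj))] at h2
    rw [← h2]
    congr 1
    ext x
    rw [Finset.prod_insert hi]
    ring

theorem batchCost_nonneg (S : Finset (Fin n)) : 0 ≤ P.batchCost S :=
  add_nonneg P.ρ_nonneg (Finset.sum_nonneg fun i _ => P.c_nonneg i)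

end Items

/-! ### Truncation and optional stopping for adaptive policies -/

namespace AdaptivePolicy

variable {n : ℕ} (P : Items n)

theorem cost_nonneg (A : AdaptivePolicy n) (x : Fin n → Bool) : 0 ≤ A.cost P x := by
  induction A with
  | halt => simp [cost]
  | test S next ih => exact add_nonneg (P.batchCost_nonneg S) (ih _)

theorem sum_tested_le_cost (A : AdaptivePolicy n) (x : Fin n → Bool) :
    ∑ i ∈ A.tested x, P.c i ≤ A.cost P x := by
  induction A with
  | halt => simp [cost, tested]
  | test S next ih =>
    have h1 := ih (fun i => x i)
    have h2 := Finset.sum_union_inter (s₁ := S) (s₂ := (next fun i => x i).tested x) (f := P.c)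
    have h3 : 0 ≤ ∑ i ∈ S ∩ (next fun i => x i).tested x, P.c i :=
      Finset.sum_nonneg fun i _ => P.c_nonneg i
    have h4 := P.ρ_nonneg
    simp only [tested, cost, Items.batchCost]
    linarith

/-- The decision to test `i` precedes the sight of its outcome, so it is independent of that
outcome. -/
theorem mem_tested_update (A : AdaptivePolicy n) (x : Fin n → Bool) (i : Fin n) (b : Bool) :
    i ∈ A.tested (Function.update x i b) ↔ i ∈ A.tested x := by
  induction A with
  | halt => simp [tested]
  | test S next ih =>
    simp only [tested, Finset.mem_union]
    by_cases hi : i ∈ S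
    · simp [hi]
    · have : (fun j : S => Function.update x i b j) = fun j : S => x j := by
        ext j
        rw [Function.update_of_ne]
        rintro rfl
        exact hi j.2
      rw [this, ih]

open Classical in
/-- The policy that stops before its cost would exceed `L`. -/
noncomputable def truncate : AdaptivePolicy n → ℝ → AdaptivePolicy n
  | halt, _ => halt
  | test S next, L =>
    if P.batchCost S ≤ L then test S fun y => (next y).truncate (L - P.batchCost S) else halt

theorem cost_truncate_le (A : AdaptivePolicy n) {L : ℝ} (hL : 0 ≤ L) (x : Fin n → Bool) :
    (A.truncate P L).cost P x ≤ L := by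
  induction A generalizing L with
  | halt => simpa [truncate, cost] using hL
  | test S next ih =>
    unfold truncate
    split_ifs with h
    · have := ih (fun i => x i) (sub_nonneg.mpr h)
      simp only [cost]
      linarith
    · simpa [cost] using hL

theorem tested_truncate (A : AdaptivePolicy n) {L : ℝ} {x : Fin n → Bool}
    (h : A.cost P x ≤ L) : (A.truncate P L).tested x = A.tested x := by
  induction A generalizing L with
  | halt => rfl
  | test S next ih =>
    simp only [cost] at h
    have h0 := cost_nonneg P (next fun i => x i) x
    unfold truncate
    rw [if_pos (by linarith)]
    simp only [tested]
    rw [ih (fun i => x i) (by linarith)]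

/-- Given the run of the policy, the untested items still have their original distribution, so
mean-one factors on them integrate out although the set of these items is random. -/
theorem expect_mul_prod_sdiff_tested (A : AdaptivePolicy n) {F : (Fin n → Bool) → ℝ}
    {S : Finset (Fin n)} (hF : ∀ i ∈ S, IgnoresCoord F i) {Y : Fin n → Bool → ℝ}
    (hY : ∀ i ∈ S, ∑ b, P.outcomeProb i b * Y i b = 1) :
    P.expect (fun x => F x * ∏ i ∈ S \ A.tested x, Y i (x i)) = P.expect F := by
  classical
  induction A generalizing F S with
  | halt => simpa [tested] using P.expect_mul_prod hF hY
  | test B next ih =>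
    have hsplit : ∀ G : (Fin n → Bool) → ℝ, P.expect G =
        ∑ y : B → Bool, P.expect (fun x => if (fun i : B => x i) = y then G x else 0) := by
      intro G
      rw [← P.expect_sum]
      congr 1
      ext x
      simp
    rw [hsplit, hsplit F]
    refine Finset.sum_congr rfl fun y _ => ?_
    -- Condition on the outcomes `y` of the first batch: their indicator joins `F`, which then
    -- ignores only the items outside `B`.
    rw [← ih y (F := fun x => if (fun i : B => x i) = y then F x else 0) (S := S \ B)]
    · congr 1
      ext x
      split_ifs with h
      · simp only [tested, h, Finset.sdiff_union_distrib, ← Finset.sdiff_sdiff_left']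
      · simp
    · intro i hi x b
      rw [Finset.mem_sdiff] at hi
      have : (fun j : B => Function.update x i b j) = fun j : B => x j := by
        ext j
        rw [Function.update_of_ne]
        rintro rfl
        exact hi.2 j.2
      simp only [this, hF i hi.1 x b]
    · exact fun i hi => hY i (Finset.mem_sdiff.mp hi).1

/-- Optional stopping: if the expected value of every affordable item outside `V` is at most
`θ` times its cost, then so is the expected value that a policy of cost at most `L` collects
outside `V`. -/
theorem expect_sum_tested_sdiff_le (A : AdaptivePolicy n) {L θ : ℝ} (hθ : 0 ≤ θ)
    (hA : ∀ x, A.cost P x ≤ L) {F : (Fin n → Bool) → ℝ} (hF0 : ∀ x, 0 ≤ F x)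
    {V : Finset (Fin n)} (hF : ∀ i ∉ V, IgnoresCoord F i) {v : Fin n → Bool → ℝ}
    (hv : ∀ i ∉ V, P.c i ≤ L → ∑ b, P.outcomeProb i b * v i b ≤ θ * P.c i) :
    P.expect (fun x => F x * ∑ i ∈ A.tested x \ V, v i (x i)) ≤ θ * L * P.expect F := by
  classical
  have hrew : ∀ (x : Fin n → Bool) (g : Fin n → ℝ), F x * ∑ i ∈ A.tested x \ V, g i =
      ∑ i ∈ Finset.univ \ V, (if i ∈ A.tested x then F x else 0) * g i := by
    intro x g
    have : A.tested x \ V = (Finset.univ \ V).filter (· ∈ A.tested x) := by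
      ext i; simp [and_comm]
    rw [this, Finset.sum_filter, Finset.mul_sum]
    refine Finset.sum_congr rfl fun i _ => ?_
    split_ifs <;> simp
  have hc : ∀ x, ∑ i ∈ A.tested x \ V, P.c i ≤ L := fun x =>
    ((Finset.sum_le_sum_of_subset_of_nonneg Finset.sdiff_subset
      fun i _ _ => P.c_nonneg i).trans (sum_tested_le_cost P A x)).trans (hA x)
  calc P.expect (fun x => F x * ∑ i ∈ A.tested x \ V, v i (x i))
      = ∑ i ∈ Finset.univ \ V,
          P.expect (fun x => (if i ∈ A.tested x then F x else 0) * v i (x i)) := by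
        rw [← P.expect_sum]
        congr 1
        ext x
        exact hrew x _
    _ ≤ ∑ i ∈ Finset.univ \ V,
          P.expect (fun x => (if i ∈ A.tested x then F x else 0) * (θ * P.c i)) := by
        refine Finset.sum_le_sum fun i hi => ?_
        have hi : i ∉ V := (Finset.mem_sdiff.mp hi).2
        by_cases hiL : P.c i ≤ L
        · have hig : IgnoresCoord (fun x => if i ∈ A.tested x then F x else 0) i := by
            intro x b
            simp only [mem_tested_update, hF i hi x b]
          rw [P.expect_mul_coord hig]
          rw [P.expect_mul_const]
          refine mul_le_mul_of_nonneg_left (hv i hi hiL) (P.expect_nonneg fun x => ?_)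
          split_ifs
          exacts [hF0 x, le_rfl]
        · refine P.expect_mono fun x => ?_
          have : i ∉ A.tested x := fun h => hiL <|
            (Finset.single_le_sum (fun j _ => P.c_nonneg j) h).trans
              ((sum_tested_le_cost P A x).trans (hA x))
          simp [this]
    _ = P.expect (fun x => θ * (F x * ∑ i ∈ A.tested x \ V, P.c i)) := by
        rw [← P.expect_sum]
        congr 1
        ext x
        rw [hrew x, Finset.mul_sum]
        exact Finset.sum_congr rfl fun i _ => by ring
    _ ≤ P.expect (fun x => θ * L * F x) := by
        refine P.expect_mono fun x => ?_
        rw [mul_assoc, mul_comm L]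
        exact mul_le_mul_of_nonneg_left (mul_le_mul_of_nonneg_left (hc x) (hF0 x)) hθ
    _ = θ * L * P.expect F := P.expect_const_mul _ _

end AdaptivePolicy
end SeqTesting

/-! ### One batch that dominates every policy of a given cost -/

namespace SeqTesting

variable {n : ℕ}

/-- Total reward of the items in `S`, where item `i` yields `a i` if its outcome is `b i`. -/
def reward (a : Fin n → ℝ) (b : Fin n → Bool) (S : Finset (Fin n)) (x : Fin n → Bool) : ℝ :=
  ∑ i ∈ S, if x i = b i then a i else 0

theorem reward_mono {a : Fin n → ℝ} (ha : ∀ i, 0 ≤ a i) (b : Fin n → Bool)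
    {S T : Finset (Fin n)} (h : S ⊆ T) (x : Fin n → Bool) : reward a b S x ≤ reward a b T x :=
  Finset.sum_le_sum_of_subset_of_nonneg h fun i _ _ => by
    split_ifs
    exacts [ha i, le_rfl]

theorem reward_le_of_sdiff_le (a : Fin n → ℝ) (b : Fin n → Bool) {S T : Finset (Fin n)}
    {x : Fin n → Bool} (h : reward a b (T \ S) x ≤ reward a b (S \ T) x) :
    reward a b T x ≤ reward a b S x := by
  have h1 := Finset.sum_sdiff_sub_sum_sdiff (s₁ := S) (s₂ := T)
    (f := fun i => if x i = b i then a i else 0)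
  unfold reward at *
  linarith

/-- A greedy initial segment of `E`, in the order of decreasing `key`, that fills the budget. -/
theorem exists_greedy_prefix {ι : Type*} [DecidableEq ι] (E : Finset ι) (key c : ι → ℝ)
    {B : ℝ} (hB : 0 ≤ B) :
    ∃ S ⊆ E, ∑ i ∈ S, c i ≤ B ∧ (S = E ∨ ∃ j ∈ E \ S, B < ∑ i ∈ S, c i + c j ∧
      (∀ i ∈ S, key j ≤ key i) ∧ ∀ i ∈ E \ S, key i ≤ key j) := by
  classical
  -- A largest affordable prefix works: adding the best remaining item keeps it a prefix, so it must
  -- break the budget.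
  obtain ⟨S, hS, hmax⟩ := Finset.exists_max_image
    (E.powerset.filter fun S => ∑ i ∈ S, c i ≤ B ∧ ∀ i ∈ S, ∀ j ∈ E \ S, key j ≤ key i)
    Finset.card ⟨∅, by simp [hB]⟩
  simp only [Finset.mem_filter, Finset.mem_powerset] at hS hmax
  obtain ⟨hSE, hSB, hpre⟩ := hS
  refine ⟨S, hSE, hSB, ?_⟩
  rcases (E \ S).eq_empty_or_nonempty with h | h
  · exact Or.inl (hSE.antisymm (Finset.sdiff_eq_empty_iff_subset.mp h))
  · obtain ⟨j, hj, hjmax⟩ := Finset.exists_max_image (E \ S) key h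
    have hj' := Finset.mem_sdiff.mp hj
    refine Or.inr ⟨j, hj, ?_, fun i hi => hpre i hi j hj, hjmax⟩
    by_contra hcon
    have := hmax (insert j S) ⟨Finset.insert_subset hj'.1 hSE, by
      rw [Finset.sum_insert hj'.2]
      linarith, by
      intro i hi k hk
      simp only [Finset.mem_sdiff, Finset.mem_insert, not_or] at hk
      have hk' : k ∈ E \ S := Finset.mem_sdiff.mpr ⟨hk.1, hk.2.2⟩
      rcases Finset.mem_insert.mp hi with rfl | hi
      · exact hjmax k hk'
      · exact hpre i hi k hk'⟩
    rw [Finset.card_insert_of_notMem hj'.2] at this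
    omega

theorem Items.sum_outcomeProb_ite (P : Items n) (i : Fin n) (b : Bool) (u w : ℝ) :
    ∑ β, P.outcomeProb i β * (if β = b then u else w) =
      P.outcomeProb i b * u + (1 - P.outcomeProb i b) * w := by
  cases b <;> simp [Items.outcomeProb, add_comm]

/-- A batch of cost `dominationFactor δ * L` suffices to collect, up to failure probability `δ`,
the reward of every adaptive policy of cost `L`. -/
noncomputable def dominationFactor (δ : ℝ) : ℝ := 2 + 2 * (2 + 2 * Real.log (2 / δ)) / δ

theorem two_le_dominationFactor {δ : ℝ} (hδ : 0 < δ) (hδ1 : δ ≤ 1) : 2 ≤ dominationFactor δ := by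
  have : 0 ≤ Real.log (2 / δ) := Real.log_nonneg (by rw [le_div_iff₀ hδ]; linarith)
  have : 0 ≤ 2 * (2 + 2 * Real.log (2 / δ)) / δ := by positivity
  unfold dominationFactor
  linarith

theorem exp_neg_le_one_sub_half {m : ℝ} (h0 : 0 ≤ m) (h1 : m ≤ 1) :
    Real.exp (-m) ≤ 1 - m / 2 := by
  rw [Real.exp_neg, inv_le_comm₀ (Real.exp_pos m) (by linarith)]
  refine le_trans ?_ (Real.add_one_le_exp m)
  rw [inv_le_iff_one_le_mul₀ (by linarith)]
  nlinarith

/-- Lower tail bound for the truncated reward of the items that a policy leaves untested. -/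
theorem expect_mul_prod_exp_neg_le (P : Items n) (A : AdaptivePolicy n)
    {F : (Fin n → Bool) → ℝ} (hF0 : ∀ x, 0 ≤ F x) {S : Finset (Fin n)}
    (hF : ∀ i ∈ S, IgnoresCoord F i) {m : Fin n → ℝ} (hm0 : ∀ i, 0 ≤ m i) (hm1 : ∀ i, m i ≤ 1)
    (b : Fin n → Bool) {D : ℝ}
    (hD : ∀ x, D ≤ ∑ i ∈ S \ A.tested x, P.outcomeProb i (b i) * m i) :
    P.expect (fun x => F x * ∏ i ∈ S \ A.tested x, Real.exp (-(if x i = b i then m i else 0))) ≤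
      Real.exp (-D / 2) * P.expect F := by
  set M : Fin n → ℝ := fun i => ∑ β, P.outcomeProb i β * Real.exp (-(if β = b i then m i else 0))
    with hM
  have hMe : ∀ i, M i = P.outcomeProb i (b i) * Real.exp (-m i) +
      (1 - P.outcomeProb i (b i)) := by
    intro i
    rw [← mul_one (1 - P.outcomeProb i (b i)), ← P.sum_outcomeProb_ite]
    refine Finset.sum_congr rfl fun β _ => ?_
    split_ifs <;> simp
  have hq1 : ∀ i, P.outcomeProb i (b i) ≤ 1 := fun i => by
    rw [← P.sum_outcomeProb i]
    exact Finset.single_le_sum (fun β _ => P.outcomeProb_nonneg i β) (Finset.mem_univ _)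
  have hM0 : ∀ i, 0 < M i := by
    intro i
    rw [hMe]
    have h1 := Real.exp_pos (-m i)
    have h2 : Real.exp (-m i) ≤ 1 := by simpa using hm0 i
    have h3 := P.outcomeProb_nonneg i (b i)
    nlinarith [hq1 i]
  have hMle : ∀ i, M i ≤ Real.exp (-(P.outcomeProb i (b i) * m i) / 2) := by
    intro i
    have h1 := exp_neg_le_one_sub_half (hm0 i) (hm1 i)
    have h2 := Real.add_one_le_exp (-(P.outcomeProb i (b i) * m i) / 2)
    have h3 := mul_le_mul_of_nonneg_left h1 (P.outcomeProb_nonneg i (b i))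
    rw [hMe]
    linarith
  -- Dividing each exponential by its mean `M i` gives mean-one factors; the product of the means is
  -- bounded separately through `hMle`.
  have hY := A.expect_mul_prod_sdiff_tested P hF
    (Y := fun i β => Real.exp (-(if β = b i then m i else 0)) / M i) (fun i _ => by
      simp only [← mul_div_assoc, ← Finset.sum_div]
      exact div_self (hM0 i).ne')
  rw [← hY, ← P.expect_const_mul]
  refine P.expect_mono fun x => ?_
  have h1 : ∏ i ∈ S \ A.tested x, Real.exp (-(if x i = b i then m i else 0)) =
      (∏ i ∈ S \ A.tested x, M i) *
        ∏ i ∈ S \ A.tested x, Real.exp (-(if x i = b i then m i else 0)) / M i := by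
    rw [← Finset.prod_mul_distrib]
    exact Finset.prod_congr rfl fun i _ => (mul_div_cancel₀ _ (hM0 i).ne').symm
  have h2 : ∏ i ∈ S \ A.tested x, M i ≤ Real.exp (-D / 2) := by
    refine (Finset.prod_le_prod (fun i _ => (hM0 i).le) fun i _ => hMle i).trans ?_
    rw [← Real.exp_sum, Real.exp_le_exp, ← Finset.sum_div, Finset.sum_neg_distrib]
    linarith [hD x]
  have h3 : 0 ≤ ∏ i ∈ S \ A.tested x, Real.exp (-(if x i = b i then m i else 0)) / M i :=
    Finset.prod_nonneg fun i _ => div_nonneg (Real.exp_pos _).le (hM0 i).le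
  rw [h1]
  have := mul_le_mul_of_nonneg_left (mul_le_mul_of_nonneg_right h2 h3) (hF0 x)
  linarith

open Classical in
-- The batch is chosen before `A` and `F`. The weight `F` lets later phases condition on the
-- outcomes in `Z`.
theorem exists_dominating_batch (P : Items n) {a : Fin n → ℝ} (ha : ∀ i, 0 ≤ a i)
    (b : Fin n → Bool) (Z : Finset (Fin n)) {L δ : ℝ} (hL : 0 < L) (hδ : 0 < δ) (hδ1 : δ ≤ 1) :
    ∃ S, Disjoint Z S ∧ ∑ i ∈ S, P.c i ≤ dominationFactor δ * L ∧
      ∀ (A : AdaptivePolicy n) (F : (Fin n → Bool) → ℝ), (∀ x, 0 ≤ F x) →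
        (∀ i ∉ Z, IgnoresCoord F i) →
        P.expect (fun x => if A.cost P x ≤ L ∧ reward a b (Z ∪ S) x < reward a b (A.tested x) x
          then F x else 0) ≤ δ * P.expect F := by
  set q : Fin n → ℝ := fun i => P.outcomeProb i (b i) with hq
  have hq0 : ∀ i, 0 ≤ q i := fun i => P.outcomeProb_nonneg i (b i)
  -- Value `θ` per unit of cost makes a budget `L` worth `δ / 2`, the share of failure left to
  -- Markov.
  set θ : ℝ := δ / (2 * L) with hθdef
  have hθ : 0 < θ := by positivity
  have hθL : θ * L = δ / 2 := by rw [hθdef]; field_simp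
  set K := dominationFactor δ with hKdef
  have hK2 : 2 ≤ K := two_le_dominationFactor hδ hδ1
  -- Candidates for purchase. Free items go to `O` and are all taken; an item with `q i ≤ θ * P.c i`
  -- is too unlikely to help for its cost.
  set E : Finset (Fin n) := Finset.univ.filter fun i =>
    i ∉ Z ∧ 0 < P.c i ∧ P.c i ≤ L ∧ θ * P.c i < q i ∧ 0 < a i with hE
  set O : Finset (Fin n) := Finset.univ.filter fun i => i ∉ Z ∧ P.c i = 0 with hO
  obtain ⟨S, hSE, hSB, hS⟩ := exists_greedy_prefix E (fun i => q i * a i / P.c i) P.c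
    (B := K * L) (by positivity)
  have hSmem : ∀ i ∈ S, i ∉ Z ∧ 0 < P.c i ∧ P.c i ≤ L ∧ θ * P.c i < q i ∧ 0 < a i := by
    intro i hi
    simpa [hE] using hSE hi
  refine ⟨O ∪ S, ?_, ?_, fun A F hF0 hF => ?_⟩
  · rw [Finset.disjoint_right]
    intro i hi
    rcases Finset.mem_union.mp hi with hi | hi
    · exact (Finset.mem_filter.mp hi).2.1
    · exact (hSmem i hi).1
  · have h1 := Finset.sum_union_inter (s₁ := O) (s₂ := S) (f := P.c)
    have h2 : ∑ i ∈ O, P.c i = 0 := Finset.sum_eq_zero fun i hi => (Finset.mem_filter.mp hi).2.2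
    have h3 : 0 ≤ ∑ i ∈ O ∩ S, P.c i := Finset.sum_nonneg fun i _ => P.c_nonneg i
    linarith
  set V := Z ∪ (O ∪ S) with hV
  set A' := A.truncate P L with hA'
  have hA'c : ∀ x, A'.cost P x ≤ L := A.cost_truncate_le P hL.le
  have hFV : ∀ i ∉ V, IgnoresCoord F i := fun i hi =>
    hF i fun h => hi (Finset.mem_union_left _ h)
  have hout : ∀ i ∉ V, P.c i ≤ L → 0 < P.c i ∧ (a i = 0 ∨ q i ≤ θ * P.c i ∨ i ∈ E \ S) := by
    intro i hi hiL
    simp only [hV, Finset.mem_union, not_or] at hi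
    have hc : 0 < P.c i := lt_of_le_of_ne (P.c_nonneg i) fun h => hi.2.1 <| by
      simp [hO, hi.1, h.symm]
    refine ⟨hc, ?_⟩
    by_contra! hcon
    refine hcon.2.2 (Finset.mem_sdiff.mpr ⟨?_, hi.2.2⟩)
    simp only [hE, Finset.mem_filter, Finset.mem_univ, true_and]
    exact ⟨hi.1, hc, hiL, hcon.2.1, lt_of_le_of_ne (ha i) (Ne.symm hcon.1)⟩
  rcases hS with rfl | ⟨j, hj, hjB, hjS, hjE⟩
  -- All candidates fit. By Markov, the policy rarely finds even one positive reward outside `V`.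
  · have hmark := A'.expect_sum_tested_sdiff_le P hθ.le hA'c hF0 hFV
      (v := fun i β => if β = b i then (if 0 < a i then 1 else 0) else 0) (by
        intro i hi hiL
        rw [P.sum_outcomeProb_ite]
        obtain ⟨hc, h | h | h⟩ := hout i hi hiL
        · simp [h]
          positivity
        · have := hq0 i
          split_ifs <;> simp only [hq] at * <;> nlinarith
        · simp at h)
    rw [hθL] at hmark
    have : P.expect (fun x => if A.cost P x ≤ L ∧
        reward a b V x < reward a b (A.tested x) x then F x else 0) ≤ δ / 2 * P.expect F := by
      refine (P.expect_mono fun x => ?_).trans hmark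
      have hs0 : ∀ i, (0 : ℝ) ≤ if x i = b i then (if 0 < a i then 1 else 0) else 0 := by
        intro i
        split_ifs <;> norm_num
      split_ifs with h
      · have ht : A'.tested x = A.tested x := A.tested_truncate P h.1
        rw [ht]
        refine le_mul_of_one_le_right (hF0 x) ?_
        by_contra! hcon
        refine absurd h.2 (not_lt.mpr (reward_le_of_sdiff_le a b ?_))
        have : reward a b (A.tested x \ V) x = 0 := by
          refine Finset.sum_eq_zero fun i hi => ?_
          split_ifs with hx
          · have h1 := (Finset.single_le_sum (fun i _ => hs0 i) hi).trans_lt hcon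
            rw [if_pos hx] at h1
            split_ifs at h1 with h2
            · exact absurd h1 (lt_irrefl _)
            · exact le_antisymm (not_lt.mp h2) (ha i)
          · rfl
        rw [this]
        exact Finset.sum_nonneg fun i _ => by
          split_ifs
          exacts [ha i, le_rfl]
      · exact mul_nonneg (hF0 x) (Finset.sum_nonneg fun i _ => hs0 i)
    have h0 := P.expect_nonneg hF0
    nlinarith
  · obtain ⟨hjmem, hjnS⟩ := Finset.mem_sdiff.mp hj
    obtain ⟨hjZ, hjc, hjL, hjq, hja⟩ : j ∉ Z ∧ 0 < P.c j ∧ P.c j ≤ L ∧ θ * P.c j < q j ∧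
        0 < a j := by simpa [hE] using hjmem
    have hqj : 0 < q j := lt_trans (by positivity) hjq
    -- With this scale the marginal item `j` has expected reward exactly `θ * τ` per unit of cost,
    -- so `θ` separates the bought items from those left out.
    set τ : ℝ := q j * a j / P.c j / θ with hτdef
    have hτ : 0 < τ := by positivity
    have hτθ : q j * a j / P.c j = τ * θ := by rw [hτdef]; field_simp
    set m : Fin n → ℝ := fun i => min (a i / τ) 1 with hm
    have hm0 : ∀ i, 0 ≤ m i := fun i => le_min (div_nonneg (ha i) hτ.le) zero_le_one
    have hm1 : ∀ i, m i ≤ 1 := fun i => min_le_right _ _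
    have hma : ∀ i, τ * m i ≤ a i := fun i => by
      rw [mul_comm, ← le_div_iff₀ hτ]
      exact min_le_left _ _
    have hmark := A'.expect_sum_tested_sdiff_le P hθ.le hA'c hF0 hFV
      (v := fun i β => if β = b i then m i else 0) (by
        intro i hi hiL
        rw [P.sum_outcomeProb_ite, mul_zero, add_zero]
        change q i * m i ≤ θ * P.c i
        obtain ⟨hc, h | h | h⟩ := hout i hi hiL
        · have : m i = 0 := by simp [hm, h]
          rw [this, mul_zero]
          positivity
        · exact (mul_le_of_le_one_right (hq0 i) (hm1 i)).trans h
        · have h1 := hjE i h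
          simp only [hτθ] at h1
          rw [div_le_iff₀ hc] at h1
          have h2 := mul_le_mul_of_nonneg_left (hma i) (hq0 i)
          have h3 : τ * (q i * m i) ≤ τ * (θ * P.c i) := by linarith
          exact le_of_mul_le_mul_left h3 hτ)
    rw [hθL] at hmark
    have hSr : ∀ i ∈ S, θ * P.c i ≤ q i * m i := by
      intro i hi
      obtain ⟨-, hc, -, hqi, -⟩ := hSmem i hi
      rw [hm]
      simp only
      rw [mul_min_of_nonneg _ _ (hq0 i), mul_one]
      refine le_min ?_ hqi.le
      have h1 := hjS i hi
      simp only [hτθ] at h1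
      rw [le_div_iff₀ hc] at h1
      rw [← mul_div_assoc, le_div_iff₀ hτ]
      linarith
    set D : ℝ := 2 + 2 * Real.log (2 / δ) with hD
    have hKD : θ * ((K - 2) * L) = D := by
      have : K = 2 + 2 * D / δ := rfl
      rw [this, hθdef]
      field_simp
      ring
    have hchern := expect_mul_prod_exp_neg_le P A' hF0 (S := S)
      (fun i hi => hF i (hSmem i hi).1) hm0 hm1 b (D := D) (by
        intro x
        have h1 : ∑ i ∈ S \ A'.tested x, θ * P.c i ≤ ∑ i ∈ S \ A'.tested x, q i * m i :=
          Finset.sum_le_sum fun i hi => hSr i (Finset.mem_sdiff.mp hi).1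
        refine le_trans ?_ h1
        rw [← Finset.mul_sum, ← hKD]
        refine mul_le_mul_of_nonneg_left ?_ hθ.le
        -- `S` costs more than `K * L - P.c j ≥ (K - 1) * L`, and the policy tests at most `L` of
        -- it; hence `K - 2`.
        have h2 := Finset.sum_sdiff_sub_sum_sdiff (s₁ := S) (s₂ := A'.tested x) (f := P.c)
        have h3 : 0 ≤ ∑ i ∈ A'.tested x \ S, P.c i := Finset.sum_nonneg fun i _ => P.c_nonneg i
        have h4 := (A'.sum_tested_le_cost P x).trans (hA'c x)
        linarith)
    have hexp : Real.exp 1 * Real.exp (-D / 2) = δ / 2 := by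
      rw [← Real.exp_add]
      have : 1 + -D / 2 = -Real.log (2 / δ) := by rw [hD]; ring
      rw [this, Real.exp_neg, Real.exp_log (by positivity), inv_div]
    -- Failure forces the truncated gain outside `V` to reach 1, or that of `S` minus the tested
    -- items to stay below 1. If neither holds, no gain outside `V` is truncated, and the two sides
    -- compare through `τ`.
    calc _ ≤ P.expect (fun x =>
            F x * ∑ i ∈ A'.tested x \ V, (if x i = b i then m i else 0) + Real.exp 1 *
              (F x * ∏ i ∈ S \ A'.tested x, Real.exp (-(if x i = b i then m i else 0)))) := by
          refine P.expect_mono fun x => ?_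
          have hs0 : ∀ i, (0 : ℝ) ≤ if x i = b i then m i else 0 := by
            intro i
            split_ifs
            exacts [hm0 i, le_rfl]
          have hn1 : 0 ≤ F x * ∑ i ∈ A'.tested x \ V, (if x i = b i then m i else 0) :=
            mul_nonneg (hF0 x) (Finset.sum_nonneg fun i _ => hs0 i)
          have hn2 : 0 ≤ Real.exp 1 *
              (F x * ∏ i ∈ S \ A'.tested x, Real.exp (-(if x i = b i then m i else 0))) :=
            mul_nonneg (Real.exp_pos _).le
              (mul_nonneg (hF0 x) (Finset.prod_nonneg fun i _ => (Real.exp_pos _).le))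
          split_ifs with h
          swap
          · exact add_nonneg hn1 hn2
          have ht : A'.tested x = A.tested x := A.tested_truncate P h.1
          by_cases h1 : 1 ≤ ∑ i ∈ A'.tested x \ V, (if x i = b i then m i else 0)
          · have := le_mul_of_one_le_right (hF0 x) h1
            linarith
          by_cases h2 : ∑ i ∈ S \ A'.tested x, (if x i = b i then m i else 0) < 1
          · have h3 : 1 ≤ Real.exp 1 *
                ∏ i ∈ S \ A'.tested x, Real.exp (-(if x i = b i then m i else 0)) := by
              rw [← Real.exp_sum, ← Real.exp_add, Finset.sum_neg_distrib, Real.one_le_exp_iff]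
              linarith
            have := le_mul_of_one_le_right (hF0 x) h3
            linarith
          exfalso
          push Not at h1 h2
          refine absurd h.2 (not_lt.mpr (reward_le_of_sdiff_le a b ?_))
          rw [← ht]
          have e1 : reward a b (A'.tested x \ V) x ≤
              τ * ∑ i ∈ A'.tested x \ V, (if x i = b i then m i else 0) := by
            unfold reward
            rw [Finset.mul_sum]
            refine Finset.sum_le_sum fun i hi => ?_
            have h5 := (Finset.single_le_sum (fun i _ => hs0 i) hi).trans_lt h1
            split_ifs at h5 ⊢ with hx
            · have : m i = a i / τ := by
                rcases min_choice (a i / τ) 1 with h6 | h6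
                · exact h6
                · exact absurd h5 (by simp only [hm, h6]; exact lt_irrefl _)
              rw [this, mul_div_cancel₀ _ hτ.ne']
            · simp
          have e2 : τ * ∑ i ∈ S \ A'.tested x, (if x i = b i then m i else 0) ≤
              reward a b (S \ A'.tested x) x := by
            unfold reward
            rw [Finset.mul_sum]
            refine Finset.sum_le_sum fun i hi => ?_
            split_ifs
            · exact hma i
            · simp
          have e3 : reward a b (S \ A'.tested x) x ≤ reward a b (V \ A'.tested x) x :=
            reward_mono ha b (Finset.sdiff_subset_sdiff
              (Finset.subset_union_right.trans Finset.subset_union_right) subset_rfl) x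
          nlinarith
      _ ≤ δ / 2 * P.expect F + Real.exp 1 * (Real.exp (-D / 2) * P.expect F) := by
          rw [P.expect_add, P.expect_const_mul]
          gcongr
      _ = δ * P.expect F := by
          rw [← mul_assoc, hexp]
          ring

end SeqTesting

/-! ### Phases with doubling budgets for reward tasks -/

namespace SeqTesting

variable {n : ℕ}

/-- A testing task whose completion is monotone in finitely many reward functions. -/
structure IsRewardTask {m : ℕ} (Done : Finset (Fin n) → (Fin n → Bool) → Prop)
    (a : Fin m → Fin n → ℝ) (b : Fin m → Fin n → Bool) : Prop where
  nonneg : ∀ k i, 0 ≤ a k i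
  congr : ∀ S x y, AgreeOn S x y → Done S x → Done S y
  mono : ∀ S T x, Done T x → (∀ k, reward (a k) (b k) T x ≤ reward (a k) (b k) S x) → Done S x
  univ : ∀ x, Done Finset.univ x

/-- The cost of one phase of the non-adaptive policy for `m` rewards, relative to its budget. -/
noncomputable def phaseFactor (m : ℕ) : ℝ := m * dominationFactor (1 / (4 * m)) + 1

namespace IsRewardTask

variable {m : ℕ} {Done : Finset (Fin n) → (Fin n → Bool) → Prop}
  {a : Fin m → Fin n → ℝ} {b : Fin m → Fin n → Bool}

theorem mono_subset (h : IsRewardTask Done a b) {S T : Finset (Fin n)} (hTS : T ⊆ S)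
    {x : Fin n → Bool} (hT : Done T x) : Done S x :=
  h.mono S T x hT fun k => reward_mono (h.nonneg k) (b k) hTS x

open Classical in
-- If the batch fails although `A` is cheap, then `A` beats it in some reward. The union bound is
-- taken on the event that `Z` is not yet enough, which depends only on outcomes in `Z`; this gives
-- the factor `1 / 4` on the survival probability.
theorem exists_batch (h : IsRewardTask Done a b) (P : Items n) (hm : 0 < m)
    (Z : Finset (Fin n)) {L : ℝ} (hL : 0 < L) :
    ∃ S, Disjoint Z S ∧ ∑ i ∈ S, P.c i ≤ m * dominationFactor (1 / (4 * m)) * L ∧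
      ∀ A : AdaptivePolicy n, A.Feasible Done →
        P.expect (fun x => if Done (Z ∪ S) x then 0 else 1) ≤
          P.expect (fun x => if L < A.cost P x then 1 else 0) +
            1 / 4 * P.expect (fun x => if Done Z x then 0 else 1) := by
  have hm' : (1 : ℝ) ≤ m := by exact_mod_cast hm
  have hδ : (0 : ℝ) < 1 / (4 * m) := by positivity
  have hδ1 : (1 : ℝ) / (4 * m) ≤ 1 := by
    rw [div_le_one (by positivity)]
    linarith
  choose S hZS hSc hS using fun k => exists_dominating_batch P (h.nonneg k) (b k) Z hL hδ hδ1
  refine ⟨Finset.univ.biUnion S, ?_, ?_, fun A hA => ?_⟩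
  · rw [Finset.disjoint_biUnion_right]
    exact fun k _ => hZS k
  · calc ∑ i ∈ Finset.univ.biUnion S, P.c i ≤ ∑ k, ∑ i ∈ S k, P.c i := by
          have hle : ∀ s : Finset (Fin m),
              ∑ i ∈ s.biUnion S, P.c i ≤ ∑ k ∈ s, ∑ i ∈ S k, P.c i := by
            intro s
            induction s using Finset.induction_on with
            | empty => simp
            | insert k s hk ih =>
              rw [Finset.biUnion_insert, Finset.sum_insert hk]
              have h1 := Finset.sum_union_inter (s₁ := S k) (s₂ := s.biUnion S) (f := P.c)
              have h2 : 0 ≤ ∑ i ∈ S k ∩ s.biUnion S, P.c i :=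
                Finset.sum_nonneg fun i _ => P.c_nonneg i
              linarith
          exact hle _
      _ ≤ ∑ k : Fin m, dominationFactor (1 / (4 * m)) * L := Finset.sum_le_sum fun k _ => hSc k
      _ = m * dominationFactor (1 / (4 * m)) * L := by simp [mul_assoc]
  · set F : (Fin n → Bool) → ℝ := fun x => if Done Z x then 0 else 1 with hF
    have hF0 : ∀ x, 0 ≤ F x := fun x => by
      rw [hF]
      simp only
      split_ifs <;> norm_num
    have hFi : ∀ i ∉ Z, IgnoresCoord F i := by
      intro i hi x β
      have hag : ∀ j ∈ Z, Function.update x i β j = x j := by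
        intro j hj
        rw [Function.update_of_ne]
        rintro rfl
        exact hi hj
      have : Done Z (Function.update x i β) ↔ Done Z x :=
        ⟨h.congr Z _ _ fun j hj => (hag j hj).symm, h.congr Z _ _ hag⟩
      simp only [hF, this]
    calc P.expect (fun x => if Done (Z ∪ Finset.univ.biUnion S) x then 0 else 1)
        ≤ P.expect (fun x => (if L < A.cost P x then 1 else 0) +
          ∑ k, if A.cost P x ≤ L ∧ reward (a k) (b k) (Z ∪ S k) x <
            reward (a k) (b k) (A.tested x) x then F x else 0) := by
          refine P.expect_mono fun x => ?_
          have hs : ∀ k, 0 ≤ if A.cost P x ≤ L ∧ reward (a k) (b k) (Z ∪ S k) x <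
              reward (a k) (b k) (A.tested x) x then F x else 0 := by
            intro k
            split_ifs
            exacts [hF0 x, le_rfl]
          have hs' := Finset.sum_nonneg fun k (_ : k ∈ Finset.univ) => hs k
          by_cases h1 : Done (Z ∪ Finset.univ.biUnion S) x
          · rw [if_pos h1]
            refine add_nonneg ?_ hs'
            split_ifs <;> norm_num
          rw [if_neg h1]
          by_cases h2 : L < A.cost P x
          · rw [if_pos h2]
            linarith
          rw [if_neg h2, zero_add]
          have hZ : ¬ Done Z x := fun hd => h1 (h.mono_subset Finset.subset_union_left hd)
          have hex : ∃ k, reward (a k) (b k) (Z ∪ S k) x <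
              reward (a k) (b k) (A.tested x) x := by
            by_contra! hcon
            refine h1 (h.mono _ _ x (hA x) fun k => (hcon k).trans ?_)
            exact reward_mono (h.nonneg k) (b k) (Finset.union_subset_union_right
              (Finset.subset_biUnion_of_mem S (Finset.mem_univ k))) x
          obtain ⟨k, hk⟩ := hex
          refine le_trans ?_ (Finset.single_le_sum (fun k _ => hs k) (Finset.mem_univ k))
          rw [if_pos ⟨not_lt.mp h2, hk⟩, hF]
          simp [hZ]
      _ ≤ P.expect (fun x => if L < A.cost P x then 1 else 0) +
          ∑ k : Fin m, 1 / (4 * m) * P.expect F := by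
          rw [P.expect_add, P.expect_sum]
          gcongr with k
          exact hS k A F hF0 hFi
      _ = _ := by
          rw [Finset.sum_const, Finset.card_univ, Fintype.card_fin, nsmul_eq_mul]
          field_simp

theorem one_le_phaseFactor (hm : 0 < m) : 1 ≤ phaseFactor m := by
  have hm' : (1 : ℝ) ≤ m := by exact_mod_cast hm
  have := two_le_dominationFactor (δ := 1 / (4 * (m : ℝ))) (by positivity) (by
    rw [div_le_one (by positivity)]
    linarith)
  unfold phaseFactor
  nlinarith

open Classical in
-- The bound is a potential that pays for the current phase and still covers the next, at budget `2
-- * L`. The function `2 * cost - L` on `L < cost` dominates the sum of those `2 ^ i * L` that lie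
-- below the cost.
theorem exists_batches (h : IsRewardTask Done a b) (P : Items n) (hm : 0 < m) (k : ℕ)
    (Z : Finset (Fin n)) {L : ℝ} (hL : 0 < L) (hρ : P.ρ ≤ L)
    (hk : P.batchCost Finset.univ ≤ 2 ^ k * L) :
    ∃ l : List (Finset (Fin n)), l.Pairwise Disjoint ∧ (∀ S ∈ l, Disjoint Z S) ∧
      Z ∪ l.foldr (· ∪ ·) ∅ = Finset.univ ∧
      ∀ A : AdaptivePolicy n, A.Feasible Done →
        P.expect (fun x => runCost P Done x Z l) ≤
          phaseFactor m * (2 * L * P.expect (fun x => if Done Z x then 0 else 1) +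
            4 * P.expect (fun x => if L < A.cost P x then 2 * A.cost P x - L else 0)) := by
  have hQ := one_le_phaseFactor hm
  induction k generalizing Z L with
  | zero =>
    -- The budget now covers everything, so one last batch takes all remaining items and ensures
    -- feasibility.
    refine ⟨[Zᶜ], List.pairwise_singleton _ _, ?_, ?_, fun A hA => ?_⟩
    · simp [disjoint_compl_right]
    · simp
    · have h1 : P.batchCost Zᶜ ≤ L := by
        refine le_trans ?_ (by simpa using hk)
        unfold Items.batchCost
        gcongr
        · exact fun i _ _ => P.c_nonneg i
        · simp
      have h2 : P.expect (fun x => runCost P Done x Z [Zᶜ]) ≤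
          L * P.expect (fun x => if Done Z x then 0 else 1) := by
        rw [← P.expect_const_mul]
        refine P.expect_mono fun x => ?_
        simp only [runCost]
        split_ifs <;> linarith
      have h3 : 0 ≤ P.expect (fun x => if Done Z x then 0 else 1) :=
        P.expect_nonneg fun x => by split_ifs <;> norm_num
      have h4 : 0 ≤ P.expect (fun x => if L < A.cost P x then 2 * A.cost P x - L else 0) :=
        P.expect_nonneg fun x => by split_ifs <;> linarith
      have h5 := mul_nonneg hL.le h3
      nlinarith
  | succ k ih =>
    obtain ⟨S, hZS, hSc, hS⟩ := h.exists_batch P hm Z hL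
    obtain ⟨l, hl, hlZ, hlu, hlc⟩ := ih (Z ∪ S) (L := 2 * L) (by linarith) (by linarith)
      (by rw [pow_succ] at hk; linarith)
    refine ⟨S :: l, ?_, ?_, ?_, fun A hA => ?_⟩
    · refine List.pairwise_cons.mpr ⟨fun T hT => ?_, hl⟩
      exact Finset.disjoint_of_subset_left Finset.subset_union_right (hlZ T hT)
    · intro T hT
      rcases List.mem_cons.mp hT with rfl | hT
      · exact hZS
      · exact Finset.disjoint_of_subset_left Finset.subset_union_left (hlZ T hT)
    · rw [List.foldr_cons, ← Finset.union_assoc, hlu]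
    · have hcost : P.batchCost S ≤ phaseFactor m * L := by
        unfold Items.batchCost phaseFactor
        linarith
      have hrun0 : ∀ (x : Fin n → Bool) (l : List (Finset (Fin n))) (U : Finset (Fin n)),
          0 ≤ runCost P Done x U l := by
        intro x l
        induction l with
        | nil => exact fun U => le_rfl
        | cons S l ih =>
          intro U
          simp only [runCost]
          split_ifs
          exacts [le_rfl, add_nonneg (P.batchCost_nonneg S) (ih _)]
      have h1 : P.expect (fun x => runCost P Done x Z (S :: l)) ≤
          phaseFactor m * L * P.expect (fun x => if Done Z x then 0 else 1) +
            P.expect (fun x => runCost P Done x (Z ∪ S) l) := by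
        rw [← P.expect_const_mul, ← P.expect_add]
        refine P.expect_mono fun x => ?_
        have := hrun0 x l (Z ∪ S)
        rw [runCost]
        split_ifs <;> linarith
      have h2 := hlc A hA
      have h3 := hS A hA
      have h4 : L * P.expect (fun x => if L < A.cost P x then 1 else 0) +
          P.expect (fun x => if 2 * L < A.cost P x then 2 * A.cost P x - 2 * L else 0) ≤
          P.expect (fun x => if L < A.cost P x then 2 * A.cost P x - L else 0) := by
        rw [← P.expect_const_mul, ← P.expect_add]
        refine P.expect_mono fun x => ?_
        split_ifs <;> linarith
      set u := P.expect (fun x => if Done Z x then 0 else 1)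
      set u' := P.expect (fun x => if Done (Z ∪ S) x then 0 else 1)
      set o := P.expect (fun x => if L < A.cost P x then 1 else 0)
      -- Of the `2 * L * u` in the potential, one half pays the current batch and the other is
      -- carried forward.
      have h5 : 2 * (2 * L) * u' ≤ 4 * (L * o) + L * u := by nlinarith
      refine h1.trans ((add_le_add_right h2 _).trans ?_)
      rw [mul_assoc, ← mul_add]
      refine mul_le_mul_of_nonneg_left ?_ (by linarith)
      linarith

/-- This supplies the initial budget: below it only free batches exist, and it already covers the
setup cost. -/
theorem exists_cost_gap (P : Items n) :
    ∃ s : ℝ, 0 < s ∧ P.ρ ≤ s ∧ ∀ S, P.batchCost S = 0 ∨ s ≤ P.batchCost S := by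
  rcases P.ρ_nonneg.eq_or_lt with hρ | hρ
  · rcases (Finset.univ.filter fun S => 0 < P.batchCost S).eq_empty_or_nonempty with h | h
    · refine ⟨1, one_pos, hρ ▸ zero_le_one, fun S => Or.inl ?_⟩
      have : S ∉ Finset.univ.filter fun S => 0 < P.batchCost S := by simp [h]
      simp only [Finset.mem_filter, Finset.mem_univ, true_and, not_lt] at this
      exact this.antisymm (P.batchCost_nonneg S)
    · obtain ⟨T, hT, hmin⟩ := Finset.exists_min_image _ P.batchCost h
      simp only [Finset.mem_filter, Finset.mem_univ, true_and] at hT hmin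
      refine ⟨P.batchCost T, hT, hρ ▸ hT.le, fun S => ?_⟩
      rcases (P.batchCost_nonneg S).eq_or_lt with h | h
      · exact Or.inl h.symm
      · exact Or.inr (hmin S h)
  · refine ⟨P.ρ, hρ, le_rfl, fun S => Or.inr ?_⟩
    exact le_add_of_nonneg_right (Finset.sum_nonneg fun i _ => P.c_nonneg i)

open Classical in
theorem exists_nonAdaptivePolicy (h : IsRewardTask Done a b) (P : Items n) (hm : 0 < m) :
    ∃ N : NonAdaptivePolicy n, N.Feasible Done ∧ ∀ A : AdaptivePolicy n, A.Feasible Done →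
      N.expectedCost P Done ≤ 10 * phaseFactor m * A.expectedCost P := by
  obtain ⟨s, hs, hρs, hgap⟩ := exists_cost_gap P
  obtain ⟨k, hk⟩ := pow_unbounded_of_one_lt (P.batchCost Finset.univ / s) one_lt_two
  rw [div_lt_iff₀ hs] at hk
  have hQ := one_le_phaseFactor hm
  have hAgap : ∀ (A : AdaptivePolicy n) x, A.cost P x = 0 ∨ s ≤ A.cost P x := by
    intro A x
    induction A with
    | halt => exact Or.inl rfl
    | test S next ih =>
      have h1 := P.batchCost_nonneg S
      have h2 := (next fun i => x i).cost_nonneg P x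
      simp only [AdaptivePolicy.cost]
      rcases hgap S with h3 | h3
      · rcases ih (fun i => x i) with h4 | h4
        · exact Or.inl (by linarith)
        · exact Or.inr (by linarith)
      · exact Or.inr (by linarith)
  -- `Z` must contain all that a policy can test for free. Then outcomes on which `A` pays nothing
  -- are finished at the start, and on the others `2 * s + 4 * (2 * cost)` is at most `10 * cost`.
  have main : ∀ Z : Finset (Fin n),
      (∀ (A : AdaptivePolicy n) x, A.cost P x = 0 → A.tested x ⊆ Z) →
      ∃ l : List (Finset (Fin n)), l.Pairwise Disjoint ∧ (∀ S ∈ l, Disjoint Z S) ∧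
        Z ∪ l.foldr (· ∪ ·) ∅ = Finset.univ ∧
        ∀ A : AdaptivePolicy n, A.Feasible Done → P.expect (fun x => runCost P Done x Z l) ≤
          10 * phaseFactor m * A.expectedCost P := by
    intro Z hZ
    obtain ⟨l, hl, hlZ, hlu, hlc⟩ := h.exists_batches P hm k Z hs hρs hk.le
    refine ⟨l, hl, hlZ, hlu, fun A hA => (hlc A hA).trans ?_⟩
    rw [mul_comm (10 : ℝ), mul_assoc (phaseFactor m)]
    refine mul_le_mul_of_nonneg_left ?_ (by linarith)
    unfold AdaptivePolicy.expectedCost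
    rw [← P.expect_const_mul, ← P.expect_const_mul, ← P.expect_const_mul, ← P.expect_add]
    refine P.expect_mono fun x => ?_
    have h0 := A.cost_nonneg P x
    rcases hAgap A x with h1 | h1
    · have : Done Z x := h.mono_subset (hZ A x h1) (hA x)
      rw [if_pos this, h1, if_neg (not_lt.mpr hs.le)]
      simp
    · split_ifs <;> linarith
  rcases P.ρ_nonneg.eq_or_lt with hρ | hρ
  -- Without a setup cost, all free items form a first batch of cost 0.
  · set Z : Finset (Fin n) := Finset.univ.filter fun i => P.c i = 0 with hZ
    have hZ0 : P.batchCost Z = 0 := by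
      unfold Items.batchCost
      rw [← hρ, zero_add]
      exact Finset.sum_eq_zero fun i hi => (Finset.mem_filter.mp hi).2
    obtain ⟨l, hl, hlZ, hlu, hlc⟩ := main Z (by
      intro A x hA i hi
      have h1 := (Finset.single_le_sum (fun j _ => P.c_nonneg j) hi).trans
        (A.sum_tested_le_cost P x)
      rw [hA] at h1
      simpa [hZ] using h1.antisymm (P.c_nonneg i))
    refine ⟨⟨Z :: l, List.pairwise_cons.mpr ⟨hlZ, hl⟩⟩, fun x => ⟨(Z :: l).length, ?_⟩,
      fun A hA => ?_⟩
    · simp only [List.take_length, List.foldr_cons]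
      rw [hlu]
      exact h.univ x
    · refine le_trans (P.expect_mono fun x => ?_) (hlc A hA)
      rw [runCost, hZ0, zero_add, Finset.empty_union]
      split_ifs with h1
      · cases l with
        | nil => exact le_rfl
        | cons S l =>
          rw [runCost, if_pos (h.mono_subset (Finset.empty_subset Z) h1)]
      · exact le_rfl
  · obtain ⟨l, hl, hlZ, hlu, hlc⟩ := main ∅ (by
      intro A x hA
      cases A with
      | halt => simp [AdaptivePolicy.tested]
      | test S next =>
        exfalso
        have h1 : P.ρ ≤ P.batchCost S :=
          le_add_of_nonneg_right (Finset.sum_nonneg fun i _ => P.c_nonneg i)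
        have h2 := (next fun i => x i).cost_nonneg P x
        simp only [AdaptivePolicy.cost] at hA
        linarith)
    refine ⟨⟨l, hl⟩, fun x => ⟨l.length, ?_⟩, hlc⟩
    rw [Finset.empty_union] at hlu
    simp only [List.take_length, hlu]
    exact h.univ x

end IsRewardTask

end SeqTesting

/-! ### The two tasks as reward tasks -/

namespace SeqTesting

variable {n : ℕ}

/-- Reward by which testing item `i` can raise the lower bound on the total weight. -/
def absWeight (w : Fin n → ℤ) (i : Fin n) : ℝ := |(w i : ℝ)|

/-- The outcome of item `i` that raises the lower bound on the total weight. -/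
def goodOutcome (w : Fin n → ℤ) (i : Fin n) : Bool := decide (0 ≤ w i)

theorem sum_weight_eq (w : Fin n → ℤ) (y : Fin n → Bool) :
    ((∑ i, if y i then w i else 0 : ℤ) : ℝ) =
      ∑ i, min (w i : ℝ) 0 + reward (absWeight w) (goodOutcome w) Finset.univ y := by
  rw [reward, ← Finset.sum_add_distrib, Int.cast_sum]
  refine Finset.sum_congr rfl fun i _ => ?_
  rcases le_or_gt 0 (w i) with h | h
  · have h' : (0 : ℝ) ≤ w i := by exact_mod_cast h
    cases hy : y i <;> simp [absWeight, goodOutcome, h, h', abs_of_nonneg h']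
  · have h' : (w i : ℝ) < 0 := by exact_mod_cast h
    cases hy : y i <;> simp [absWeight, goodOutcome, not_le.mpr h, h'.le, abs_of_neg h']

theorem reward_congr (a : Fin n → ℝ) (b : Fin n → Bool) {S : Finset (Fin n)}
    {x y : Fin n → Bool} (h : AgreeOn S x y) : reward a b S y = reward a b S x :=
  Finset.sum_congr rfl fun i hi => by rw [h i hi]

/-- A lower bound on the total weight that follows from the outcomes on `T` also follows from
those on `S` if `S` has at least the same reward. -/
theorem le_weight_of_reward_le (w : Fin n → ℤ) {α : ℤ} {S T : Finset (Fin n)}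
    {x : Fin n → Bool} (h : reward (absWeight w) (goodOutcome w) T x ≤
      reward (absWeight w) (goodOutcome w) S x)
    (hT : ∀ y, AgreeOn T x y → α ≤ ∑ i, if y i then w i else 0) (y : Fin n → Bool)
    (hy : AgreeOn S x y) : α ≤ ∑ i, if y i then w i else 0 := by
  -- The completion of the outcomes on `T` with least weight: it earns no reward outside `T`.
  set z : Fin n → Bool := fun i => if i ∈ T then x i else !goodOutcome w i with hz
  have hzT : AgreeOn T x z := fun i hi => by simp [hz, hi]
  have h1 : ((∑ i, if z i then w i else 0 : ℤ) : ℝ) ≤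
      ((∑ i, if y i then w i else 0 : ℤ) : ℝ) := by
    rw [sum_weight_eq, sum_weight_eq]
    have h2 : reward (absWeight w) (goodOutcome w) Finset.univ z =
        reward (absWeight w) (goodOutcome w) T z := by
      refine (Finset.sum_subset (Finset.subset_univ T) fun i _ hi => ?_).symm
      simp [hz, hi]
    have h3 := reward_mono (a := absWeight w) (fun i => abs_nonneg _) (goodOutcome w)
      (Finset.subset_univ S) y
    rw [h2, reward_congr _ _ hzT]
    rw [reward_congr _ _ hy] at h3
    linarith
  exact (hT z hzT).trans (by exact_mod_cast h1)

theorem sum_neg_weight (w : Fin n → ℤ) (y : Fin n → Bool) :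
    (∑ i, if y i then (-w) i else 0) = -∑ i, if y i then w i else 0 := by
  rw [← Finset.sum_neg_distrib]
  exact Finset.sum_congr rfl fun i _ => by split_ifs <;> simp

theorem weight_lt_of_reward_le (w : Fin n → ℤ) {α : ℤ} {S T : Finset (Fin n)}
    {x : Fin n → Bool} (h : reward (absWeight (-w)) (goodOutcome (-w)) T x ≤
      reward (absWeight (-w)) (goodOutcome (-w)) S x)
    (hT : ∀ y, AgreeOn T x y → (∑ i, if y i then w i else 0) < α) (y : Fin n → Bool)
    (hy : AgreeOn S x y) : (∑ i, if y i then w i else 0) < α := by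
  -- Integrality turns the strict upper bound into a lower bound for `-w`.
  have := le_weight_of_reward_le (-w) (α := -α + 1) h (fun z hz => by
    rw [sum_neg_weight]
    have := hT z hz
    omega) y hy
  rw [sum_neg_weight] at this
  omega

theorem AgreeOn.of_agreeOn {S : Finset (Fin n)} {x y z : Fin n → Bool} (h : AgreeOn S x y)
    (h' : AgreeOn S y z) : AgreeOn S x z :=
  fun i hi => (h' i hi).trans (h i hi)

/-- Knowing the class amounts to one lower and one upper bound on the same score, and the rewards do
not depend on the thresholds; hence two rewards suffice for any `B`. -/
theorem ScoreClass.isRewardTask {B : ℕ} (I : ScoreClass n B) :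
    IsRewardTask I.Determined (fun k => absWeight (![I.w, -I.w] k))
      (fun k => goodOutcome (![I.w, -I.w] k)) where
  nonneg k i := abs_nonneg _
  congr S x y h hx z hz := by rw [hx z (h.of_agreeOn hz), hx y h]
  univ x y hy := by
    have : y = x := funext fun i => hy i (Finset.mem_univ i)
    rw [this]
  mono S T x hT h y hy := by
    have hcl : ∀ z, I.InClass z (I.f z) := fun z => (I.existsUnique_inClass z).choose_spec.1
    have h0 := h 0
    have h1 := h 1
    simp only [Matrix.cons_val_zero, Matrix.cons_val_one] at h0 h1
    refine (I.existsUnique_inClass y).unique (hcl y) ⟨?_, ?_⟩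
    · exact le_weight_of_reward_le I.w h0 (fun z hz => hT z hz ▸ (hcl z).1) y hy
    · exact weight_lt_of_reward_le I.w h1 (fun z hz => hT z hz ▸ (hcl z).2) y hy

/-- A witness set of halfspaces carries over unchanged: each of its members is certified by a lower
bound if true and by an upper bound if false. -/
theorem Halfspaces.isRewardTask {d : ℕ} (I : Halfspaces n d) :
    IsRewardTask I.Witnessed (fun k => absWeight (Fin.append I.w (-I.w) k))
      (fun k => goodOutcome (Fin.append I.w (-I.w) k)) where
  nonneg k i := abs_nonneg _
  congr := by
    rintro S x y h ⟨T, hT, hf⟩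
    have hxy : ∀ k ∈ T, I.h y k = I.h x k := fun k hk => hT k hk y h
    refine ⟨T, fun k hk z hz => ?_, fun z hz => ?_⟩
    · rw [hT k hk z (h.of_agreeOn hz), hxy k hk]
    · rw [hf z fun k hk => (hz k hk).trans (hxy k hk), hf (I.h y) hxy]
  univ x := by
    refine ⟨Finset.univ, fun k _ y hy => ?_, fun z hz => ?_⟩
    · have : y = x := funext fun i => hy i (Finset.mem_univ i)
      rw [this]
    · have : z = I.h x := funext fun k => hz k (Finset.mem_univ k)
      rw [this]
  mono := by
    rintro S T x ⟨K, hK, hf⟩ h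
    refine ⟨K, fun k hk y hy => ?_, hf⟩
    have h0 := h (Fin.castAdd d k)
    have h1 := h (Fin.natAdd d k)
    simp only [Fin.append_left, Fin.append_right] at h0 h1
    have hT := hK k hk
    rcases hx : I.h x k with _ | _ <;> rw [hx] at hT
    · simp only [Halfspaces.h, decide_eq_false_iff_not, not_le] at hT ⊢
      exact weight_lt_of_reward_le (I.w k) h1 hT y hy
    · simp only [Halfspaces.h, decide_eq_true_eq] at hT ⊢
      exact le_weight_of_reward_le (I.w k) h0 hT y hy

theorem phaseFactor_add_self_le {d : ℕ} (hd : 0 < d) :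
    phaseFactor (d + d) ≤ 458 * ((d : ℝ) ^ 2 * Real.log (d + 1)) := by
  have hd1 : (1 : ℝ) ≤ d := by exact_mod_cast hd
  have h1 : phaseFactor (d + d) = 4 * d + 64 * d ^ 2 + 64 * d ^ 2 * Real.log (16 * d) + 1 := by
    have : 2 / (1 / (4 * ((d : ℝ) + d))) = 16 * d := by
      field_simp
      ring
    unfold phaseFactor dominationFactor
    push_cast
    rw [this]
    field_simp
    ring
  -- Since `d ≥ 1`, `16 ≤ (d + 1) ^ 4`, and the fifth factor absorbs `d`.
  have h2 : Real.log (16 * d) ≤ 5 * Real.log (d + 1) := by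
    rw [← Nat.cast_ofNat (n := 5), ← Real.log_pow]
    refine Real.log_le_log (by positivity) ?_
    have h3 : (2 : ℝ) ^ 4 ≤ (d + 1) ^ 4 := pow_le_pow_left₀ (by norm_num) (by linarith) 4
    nlinarith
  have h3 : 1 / 2 ≤ Real.log (d + 1) := by
    have := Real.log_le_log (by norm_num : (0 : ℝ) < 2) (by linarith : (2 : ℝ) ≤ d + 1)
    linarith [Real.log_two_gt_d9]
  have h4 : (d : ℝ) ≤ d ^ 2 := by nlinarith
  have h5 := mul_le_mul_of_nonneg_left h2 (by positivity : (0 : ℝ) ≤ 64 * (d : ℝ) ^ 2)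
  have h6 := mul_le_mul_of_nonneg_left h3 (by positivity : (0 : ℝ) ≤ 138 * (d : ℝ) ^ 2)
  rw [h1]
  linarith

theorem AdaptivePolicy.expectedCost_nonneg (P : Items n) (A : AdaptivePolicy n) :
    0 ≤ A.expectedCost P :=
  P.expect_nonneg fun x => A.cost_nonneg P x

end SeqTesting

theorem theorem3 :
    (∃ C : ℝ, ∀ (n B : ℕ) (P : SeqTesting.Items n) (I : SeqTesting.ScoreClass n B),
      ∃ N : SeqTesting.NonAdaptivePolicy n, N.Feasible I.Determined ∧
        ∀ A : SeqTesting.AdaptivePolicy n, A.Feasible I.Determined →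
          N.expectedCost P I.Determined ≤ C * A.expectedCost P) ∧
    (∃ C : ℝ, ∀ (n d : ℕ) (P : SeqTesting.Items n) (I : SeqTesting.Halfspaces n d),
      ∃ N : SeqTesting.NonAdaptivePolicy n, N.Feasible I.Witnessed ∧
        ∀ A : SeqTesting.AdaptivePolicy n, A.Feasible I.Witnessed →
          N.expectedCost P I.Witnessed ≤
            C * ((d : ℝ) ^ 2 * Real.log ((d : ℝ) + 1)) * A.expectedCost P) := by
  refine ⟨⟨_, fun n B P I => I.isRewardTask.exists_nonAdaptivePolicy P two_pos⟩,
    4580, fun n d P I => ?_⟩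
  -- For `d = 0` the stated bound is 0; the empty set is a witness and nothing is tested.
  rcases d.eq_zero_or_pos with rfl | hd
  · refine ⟨⟨[], List.Pairwise.nil⟩, fun x => ⟨0, ∅, by simp, fun z _ => ?_⟩, fun A _ => ?_⟩
    · rw [Subsingleton.elim z (I.h x)]
    · simp [SeqTesting.NonAdaptivePolicy.expectedCost, SeqTesting.runCost,
        SeqTesting.Items.expect]
  · obtain ⟨N, hN, hNA⟩ := I.isRewardTask.exists_nonAdaptivePolicy P (Nat.add_pos_left hd d)
    refine ⟨N, hN, fun A hA => (hNA A hA).trans ?_⟩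
    refine mul_le_mul_of_nonneg_right ?_ (A.expectedCost_nonneg P)
    linarith [SeqTesting.phaseFactor_add_self_le hd]
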